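/- Let $\mathbb K$ be $\mathbb R$ or $\mathbb C$. For a Banach space $X$ over $\mathbb K$, let $\mathcal L(X)$ be the Banach space of continuous linear operators on $X$ with the operator norm. An operator $T\in\mathcal L(X)$ is *supercyclic* if there is $x\in X$ such that $\{c\,T^k x : c\in\mathbb K,\ k\ge 0\}$ is dense in $X$. (1) For every infinite-dimensional separable Banach space $X$ over $\mathbb K$, the set of supercyclic operators in $\mathcal L(X)$ is spaceable: there is an infinite-dimensional closed vector subspace $M$ of $\mathcal L(X)$ all of whose non-zero elements are supercyclic. (2) Let $\ell_1$ be the Banach space of absolutely summable sequences $(\lambda_k)_{k\ge1}$ in $\mathbb K$ with $\|\lambda\|_1=\sum_{k\ge1}|\lambda_k|$, and let $B\in\mathcal L(\ell_1)$ be the backward shift, $B(x_1,x_2,x_3,\dots)=(x_2,x_3,x_4,\dots)$. For every $\lambda\in\ell_1$ the series $T_\lambda=\sum_{k=1}^\infty \lambda_k B^k$ converges in $\mathcal L(\ell_1)$; the map $\lambda\mapsto T_\lambda$ is a linear isometry of $\ell_1$ into $\mathcal L(\ell_1)$; its range is closed; and every non-zero operator in its range is supercyclic. In particular the set of supercyclic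 operators on $\ell_1$ together with $0$ contains an isometric copy of $\ell_1$. -/

import Mathlib

open Topology
open scoped ENNReal

/-- A bounded operator `T` is supercyclic if some vector has a dense projective orbit
`{c • T ^ k x : c ∈ 𝕜, k ≥ 0}`. -/
def IsSupercyclic {𝕜 X : Type*} [RCLike 𝕜] [NormedAddCommGroup X] [NormedSpace 𝕜 X]
    (T : X →L[𝕜] X) : Prop :=
  ∃ x : X, Dense {y : X | ∃ (c : 𝕜) (k : ℕ), y = c • (T ^ k) x}

/-- A subset `A` of a topological vector space is spaceable if `A ∪ {0}` contains a closed
infinite-dimensional vector subspace. -/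
def Spaceable (𝕜 : Type*) {E : Type*} [Field 𝕜] [AddCommGroup E] [Module 𝕜 E]
    [TopologicalSpace E] (A : Set E) : Prop :=
  ∃ M : Submodule 𝕜 E, ¬ FiniteDimensional 𝕜 M ∧ IsClosed (M : Set E) ∧ (M : Set E) ⊆ A ∪ {0}

/-- The Banach space `ℓ₁` of absolutely summable sequences of scalars, with the norm
`∑ |x n|`; sequences are indexed from `0`. -/
abbrev EllOne (𝕜 : Type*) [RCLike 𝕜] : Type _ := lp (fun _ : ℕ => 𝕜) 1

theorem EllOne.summable_norm {𝕜 : Type*} [RCLike 𝕜] (x : EllOne 𝕜) :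
    Summable fun n : ℕ => ‖x n‖ := by
  simpa using (lp.memℓp x).summable (by norm_num)

theorem EllOne.norm_eq {𝕜 : Type*} [RCLike 𝕜] (x : EllOne 𝕜) : ‖x‖ = ∑' n : ℕ, ‖x n‖ := by
  simpa using lp.norm_eq_tsum_rpow (p := 1) (by norm_num) x

theorem EllOne.memℓp_shift {𝕜 : Type*} [RCLike 𝕜] (x : EllOne 𝕜) :
    Memℓp (fun n : ℕ => x (n + 1)) 1 := by
  refine memℓp_gen ?_
  simpa using (summable_nat_add_iff 1).2 x.summable_norm

/-- The backward shift `(x₀, x₁, x₂, …) ↦ (x₁, x₂, x₃, …)` on `ℓ₁`. -/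
noncomputable def backwardShift (𝕜 : Type*) [RCLike 𝕜] : EllOne 𝕜 →L[𝕜] EllOne 𝕜 :=
  LinearMap.mkContinuous
    { toFun := fun x => ⟨fun n => x (n + 1), x.memℓp_shift⟩
      map_add' := fun _ _ => rfl
      map_smul' := fun _ _ => rfl } 1 (by
    intro x
    rw [one_mul, EllOne.norm_eq, EllOne.norm_eq x, x.summable_norm.tsum_eq_zero_add]
    exact le_add_of_nonneg_left (norm_nonneg _))

theorem backwardShift_apply {𝕜 : Type*} [RCLike 𝕜] (x : EllOne 𝕜) (n : ℕ) :
    backwardShift 𝕜 x n = x (n + 1) := rfl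

/-! Take `S` and vectors `e n` of dense span with `S (e 0) = 0`, `S (e (n + 1)) = e n`, `e 0 ≠ 0`.
The operators that commute with `S` and are strictly triangular along `e` form a closed subspace
containing the independent powers `S ^ (k + 1)`. Let `T ≠ 0` be one of them. If `m` is least with `T
(e m) ≠ 0`, then `S` kills `T (e m)`, so `T (e m) = c • e 0` with `c ≠ 0`; commutation propagates
this to `T (e (j + m)) = c • e j` plus lower terms (`exists_leading_coeff`). Hence the range of `T`
contains every `e j`, while `T` is nilpotent on each initial span: range and generalized kernel are
dense, and Baire gives supercyclicity. Such `S` and `e` exist in general as a weighted shift along a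
biorthogonal system (`exists_shiftsBackward`). On `ℓ₁`, the backward shift and the unit vectors
serve, and the series in its powers stay in the closed subspace. -/

/-- **Baire argument**: an operator with dense generalized kernel and dense range is supercyclic. -/
theorem IsSupercyclic.of_dense_generalizedKernel {𝕜 X : Type*} [RCLike 𝕜] [NormedAddCommGroup X]
    [NormedSpace 𝕜 X] [CompleteSpace X] [TopologicalSpace.SeparableSpace X] {T : X →L[𝕜] X}
    (hker : Dense {x : X | ∃ n : ℕ, (T ^ n) x = 0}) (hrange : DenseRange T) :
    IsSupercyclic T := by
  have : SecondCountableTopology X := UniformSpace.secondCountable_of_separable X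
  have hpow : ∀ n : ℕ, DenseRange (T ^ n : X →L[𝕜] X) := by
    intro n
    induction n with
    | zero => simpa using Function.surjective_id.denseRange
    | succ n ih =>
      rw [pow_succ]
      exact ih.comp hrange (T ^ n).continuous
  -- The vectors whose projective orbit meets `V`; a point of all `G V`, `V` basic, is a supercyclic
  -- vector.
  let G : Set X → Set X := fun V => {x | ∃ (c : 𝕜) (k : ℕ), c • (T ^ k) x ∈ V}
  have hGo : ∀ V ∈ TopologicalSpace.countableBasis X, IsOpen (G V) := by
    intro V hV
    have : G V = ⋃ (c : 𝕜) (k : ℕ), (fun x => c • (T ^ k) x) ⁻¹' V := by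
      ext x; simp [G]
    rw [this]
    exact isOpen_iUnion fun c => isOpen_iUnion fun k =>
      (TopologicalSpace.isOpen_of_mem_countableBasis hV).preimage (by fun_prop)
  have hGd : ∀ V ∈ TopologicalSpace.countableBasis X, Dense (G V) := by
    intro V hV
    have hVo := TopologicalSpace.isOpen_of_mem_countableBasis hV
    rw [dense_iff_inter_open]
    intro U hU hUn
    obtain ⟨x, hxU, n, hx⟩ := hker.inter_open_nonempty U hU hUn
    obtain ⟨z, hz⟩ := (hpow n).exists_mem_open hVo
      (TopologicalSpace.nonempty_of_mem_countableBasis hV)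
    have hev : ∀ᶠ ε : 𝕜 in 𝓝[≠] 0, x + ε • z ∈ U := by
      refine Filter.Eventually.filter_mono nhdsWithin_le_nhds ?_
      have hc : Continuous fun ε : 𝕜 => x + ε • z := by fun_prop
      exact hc.continuousAt.eventually_mem (hU.mem_nhds (by simpa using hxU))
    obtain ⟨ε, hεU, hε⟩ := (hev.and self_mem_nhdsWithin).exists
    -- `T ^ n` kills `x`, so scaling by `ε⁻¹` recovers `(T ^ n) z ∈ V` however small `ε` is.
    refine ⟨x + ε • z, hεU, ε⁻¹, n, ?_⟩
    have hε0 : ε ≠ 0 := hε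
    rwa [map_add, hx, zero_add, map_smul, smul_smul, inv_mul_cancel₀ hε0, one_smul]
  obtain ⟨x, hx⟩ := (dense_biInter_of_isOpen hGo (TopologicalSpace.countable_countableBasis X)
    hGd).nonempty
  refine ⟨x, (TopologicalSpace.isBasis_countableBasis X).dense_iff.2 fun V hV _ => ?_⟩
  obtain ⟨c, k, h⟩ := Set.mem_iInter₂.1 hx V hV
  exact ⟨_, h, c, k, rfl⟩

/-! ### Initial spans of a sequence -/

/-- The span of the first `n` terms of a sequence of vectors. -/
def initialSpan (𝕜 : Type*) {X : Type*} [Field 𝕜] [AddCommGroup X] [Module 𝕜 X] (e : ℕ → X)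
    (n : ℕ) : Submodule 𝕜 X :=
  Submodule.span 𝕜 (e '' Set.Iio n)

section InitialSpan

variable {𝕜 X : Type*} [Field 𝕜] [AddCommGroup X] [Module 𝕜 X] {e : ℕ → X}

theorem mem_initialSpan {j n : ℕ} (h : j < n) : e j ∈ initialSpan 𝕜 e n :=
  Submodule.subset_span ⟨j, h, rfl⟩

theorem initialSpan_le_iff {n : ℕ} {p : Submodule 𝕜 X} :
    initialSpan 𝕜 e n ≤ p ↔ ∀ j < n, e j ∈ p := by
  rw [initialSpan, Submodule.span_le, Set.image_subset_iff]
  rfl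

theorem initialSpan_mono : Monotone (initialSpan 𝕜 e) := fun _ _ h =>
  initialSpan_le_iff.2 fun _ hj => mem_initialSpan (hj.trans_le h)

theorem initialSpan_zero : initialSpan 𝕜 e 0 = ⊥ :=
  le_bot_iff.1 <| initialSpan_le_iff.2 fun _ hj => absurd hj (Nat.not_lt_zero _)

theorem exists_sub_mem_of_mem_initialSpan_succ {n : ℕ} {x : X}
    (h : x ∈ initialSpan 𝕜 e (n + 1)) : ∃ a : 𝕜, x - a • e n ∈ initialSpan 𝕜 e n := by
  rw [initialSpan, Set.Iio_add_one_eq_Iic, ← Set.Iio_insert, Set.image_insert_eq,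
    Submodule.mem_span_insert] at h
  obtain ⟨a, z, hz, rfl⟩ := h
  exact ⟨a, by rwa [add_sub_cancel_left]⟩

theorem exists_mem_initialSpan {x : X} (h : x ∈ Submodule.span 𝕜 (Set.range e)) :
    ∃ n, x ∈ initialSpan 𝕜 e n := by
  induction h using Submodule.span_induction with
  | mem x hx => obtain ⟨n, rfl⟩ := hx; exact ⟨n + 1, mem_initialSpan n.lt_succ_self⟩
  | zero => exact ⟨0, zero_mem _⟩
  | add x y _ _ hx hy =>
    obtain ⟨n, hn⟩ := hx
    obtain ⟨m, hm⟩ := hy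
    exact ⟨max n m, add_mem (initialSpan_mono (le_max_left n m) hn)
      (initialSpan_mono (le_max_right n m) hm)⟩
  | smul a x _ hx => obtain ⟨n, hn⟩ := hx; exact ⟨n, Submodule.smul_mem _ a hn⟩

instance (n : ℕ) : FiniteDimensional 𝕜 (initialSpan 𝕜 e n) :=
  FiniteDimensional.span_of_finite 𝕜 ((Set.finite_Iio n).image e)

end InitialSpan

/-! ### Triangular operators commuting with a shift -/

/-- `S` shifts the sequence `e` backwards, starting from a nonzero vector. -/
structure ShiftsBackward {𝕜 X : Type*} [RCLike 𝕜] [NormedAddCommGroup X] [NormedSpace 𝕜 X]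
    (S : X →L[𝕜] X) (e : ℕ → X) : Prop where
  apply_zero : S (e 0) = 0
  apply_succ : ∀ n, S (e (n + 1)) = e n
  ne_zero : e 0 ≠ 0

/-- The operators commuting with `S` and strictly upper triangular along `e`. -/
def triangularCommutant {𝕜 X : Type*} [RCLike 𝕜] [NormedAddCommGroup X] [NormedSpace 𝕜 X]
    (S : X →L[𝕜] X) (e : ℕ → X) : Submodule 𝕜 (X →L[𝕜] X) where
  carrier := {T | (∀ x, T (S x) = S (T x)) ∧ ∀ n, T (e n) ∈ initialSpan 𝕜 e n}
  add_mem' := fun hT hU => ⟨fun x => by simp [hT.1, hU.1], fun n => add_mem (hT.2 n) (hU.2 n)⟩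
  zero_mem' := ⟨fun x => by simp, fun n => zero_mem _⟩
  smul_mem' := fun c T hT => ⟨fun x => by simp [hT.1], fun n => Submodule.smul_mem _ c (hT.2 n)⟩

section Chain

variable {𝕜 X : Type*} [RCLike 𝕜] [NormedAddCommGroup X] [NormedSpace 𝕜 X]
  {S T : X →L[𝕜] X} {e : ℕ → X}

theorem isClosed_triangularCommutant :
    IsClosed (triangularCommutant S e : Set (X →L[𝕜] X)) := by
  have : (triangularCommutant S e : Set (X →L[𝕜] X)) =
      (⋂ x, {T | T (S x) = S (T x)}) ∩ ⋂ n, {T | T (e n) ∈ initialSpan 𝕜 e n} := by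
    ext T; simp [triangularCommutant]
  rw [this]
  refine (isClosed_iInter fun x => ?_).inter (isClosed_iInter fun n => ?_)
  · exact isClosed_eq (ContinuousLinearMap.apply 𝕜 X (S x)).continuous
      (S.continuous.comp (ContinuousLinearMap.apply 𝕜 X x).continuous)
  · exact (initialSpan 𝕜 e n).closed_of_finiteDimensional.preimage
      (ContinuousLinearMap.apply 𝕜 X (e n)).continuous

theorem map_mem_initialSpan (hT : T ∈ triangularCommutant S e) {n : ℕ} {x : X}
    (hx : x ∈ initialSpan 𝕜 e (n + 1)) : T x ∈ initialSpan 𝕜 e n := by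
  refine (initialSpan_le_iff (p := (initialSpan 𝕜 e n).comap T.toLinearMap)).2
    (fun j hj => ?_) hx
  exact initialSpan_mono (Nat.lt_succ_iff.1 hj) (hT.2 j)

theorem pow_apply_eq_zero_of_mem_initialSpan (hT : T ∈ triangularCommutant S e) {n : ℕ} :
    ∀ {x : X}, x ∈ initialSpan 𝕜 e n → (T ^ n) x = 0 := by
  induction n with
  | zero => intro x hx; simpa [initialSpan_zero] using hx
  | succ n ih =>
    intro x hx
    rw [pow_succ, mul_apply_eq_comp]
    exact ih (map_mem_initialSpan hT hx)

namespace ShiftsBackward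

variable (hS : ShiftsBackward S e)
include hS

theorem mem_triangularCommutant : S ∈ triangularCommutant S e := by
  refine ⟨fun x => rfl, fun n => ?_⟩
  cases n with
  | zero => rw [hS.apply_zero]; exact zero_mem _
  | succ n => rw [hS.apply_succ]; exact mem_initialSpan n.lt_succ_self

theorem pow_apply_add (k n : ℕ) : (S ^ k) (e (n + k)) = e n := by
  induction k with
  | zero => simp
  | succ k ih => rw [pow_succ, mul_apply_eq_comp, ← add_assoc, hS.apply_succ, ih]

theorem pow_apply_of_lt {k n : ℕ} (h : n < k) : (S ^ k) (e n) = 0 :=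
  pow_apply_eq_zero_of_mem_initialSpan hS.mem_triangularCommutant (mem_initialSpan h)

/-- If `e (n + 1)` is the top term of `x`, with coefficient `a`, then `S ^ (n + 1)` turns `x` into
`a • e 0`; so `S x = 0` forces `a = 0`, and the top index descends. -/
theorem mem_initialSpan_one {n : ℕ} :
    ∀ {x : X}, x ∈ initialSpan 𝕜 e n → S x = 0 → x ∈ initialSpan 𝕜 e 1 := by
  induction n with
  | zero => exact fun hx _ => initialSpan_mono (Nat.zero_le 1) hx
  | succ n ih =>
    intro x hx hSx
    obtain _ | n := n
    · exact hx
    obtain ⟨a, ha⟩ := exists_sub_mem_of_mem_initialSpan_succ hx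
    have h0 := pow_apply_eq_zero_of_mem_initialSpan hS.mem_triangularCommutant ha
    have hx0 : (S ^ (n + 1)) x = 0 := by rw [pow_succ, mul_apply_eq_comp, hSx, map_zero]
    have he : (S ^ (n + 1)) (e (n + 1)) = e 0 := by simpa using hS.pow_apply_add (n + 1) 0
    rw [map_sub, hx0, map_smul, he, zero_sub, neg_eq_zero, smul_eq_zero] at h0
    obtain rfl := h0.resolve_right hS.ne_zero
    exact ih (by simpa using ha) hSx

/-- `S x` lifts to some `u` in the span of `e 0, …, e j`, and `x - u` is killed by `S`. The index
`n` is only an a priori bound. -/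
theorem mem_initialSpan_succ {n j : ℕ} {x : X} (hx : x ∈ initialSpan 𝕜 e n)
    (hSx : S x ∈ initialSpan 𝕜 e j) : x ∈ initialSpan 𝕜 e (j + 1) := by
  have hle : initialSpan 𝕜 e j ≤ (initialSpan 𝕜 e (j + 1)).map S.toLinearMap :=
    initialSpan_le_iff.2 fun i hi =>
      ⟨e (i + 1), mem_initialSpan (Nat.succ_lt_succ hi), hS.apply_succ i⟩
  obtain ⟨u, hu, hSu⟩ := hle hSx
  have hmem : x - u ∈ initialSpan 𝕜 e 1 := by
    refine hS.mem_initialSpan_one (n := max n (j + 1))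
      (sub_mem (initialSpan_mono (le_max_left _ _) hx) (initialSpan_mono (le_max_right _ _) hu)) ?_
    rw [map_sub, sub_eq_zero]
    exact hSu.symm
  have := add_mem (initialSpan_mono (Nat.le_add_left 1 j) hmem) hu
  rwa [sub_add_cancel] at this

theorem exists_leading_coeff (hd : Dense (Submodule.span 𝕜 (Set.range e) : Set X))
    (hT : T ∈ triangularCommutant S e) (hT0 : T ≠ 0) :
    ∃ (c : 𝕜) (m : ℕ), c ≠ 0 ∧ ∀ j, T (e (j + m)) - c • e j ∈ initialSpan 𝕜 e j := by
  classical
  have hex : ∃ n, T (e n) ≠ 0 := by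
    by_contra! h
    refine hT0 (ContinuousLinearMap.ext_on hd ?_)
    rintro _ ⟨n, rfl⟩
    simp [h n]
  obtain ⟨m, hm, hmin⟩ : ∃ m, T (e m) ≠ 0 ∧ ∀ i < m, T (e i) = 0 :=
    ⟨Nat.find hex, Nat.find_spec hex, fun i hi => not_not.1 (Nat.find_min hex hi)⟩
  have hSTm : S (T (e m)) = 0 := by
    rw [← hT.1]
    cases m with
    | zero => rw [hS.apply_zero, map_zero]
    | succ m => rw [hS.apply_succ, hmin m m.lt_succ_self]
  obtain ⟨c, hc⟩ := exists_sub_mem_of_mem_initialSpan_succ (hS.mem_initialSpan_one (hT.2 m) hSTm)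
  refine ⟨c, m, ?_, fun j => ?_⟩
  · rintro rfl
    rw [initialSpan_zero, zero_smul, sub_zero, Submodule.mem_bot] at hc
    exact hm hc
  · induction j with
    | zero => rwa [zero_add]
    | succ j ih =>
      -- `S` maps the difference at `j + 1` to the difference at `j`; the maximum is merely a common
      -- initial span.
      refine hS.mem_initialSpan_succ (n := max (j + 1 + m) (j + 2))
        (sub_mem (initialSpan_mono (le_max_left _ _) (hT.2 _)) (Submodule.smul_mem _ c
          (initialSpan_mono (le_max_right _ _) (mem_initialSpan (j + 1).lt_succ_self)))) ?_
      rwa [map_sub, map_smul, hS.apply_succ, ← hT.1, add_right_comm, hS.apply_succ]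

theorem isSupercyclic_of_mem [CompleteSpace X] [TopologicalSpace.SeparableSpace X]
    (hd : Dense (Submodule.span 𝕜 (Set.range e) : Set X))
    (hT : T ∈ triangularCommutant S e) (hT0 : T ≠ 0) : IsSupercyclic T := by
  obtain ⟨c, m, hc, hlead⟩ := hS.exists_leading_coeff hd hT hT0
  have hrange : ∀ n, initialSpan 𝕜 e n ≤ LinearMap.range T.toLinearMap := by
    intro n
    induction n with
    | zero => rw [initialSpan_zero]; exact bot_le
    | succ n ih =>
      refine initialSpan_le_iff.2 fun j hj => ?_
      obtain hj | rfl := Nat.lt_succ_iff_lt_or_eq.1 hj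
      · exact ih (mem_initialSpan hj)
      -- `c • e j` is `T (e (j + m))` minus lower terms already in the range.
      · have h := sub_mem (LinearMap.mem_range_self T.toLinearMap (e (j + m))) (ih (hlead j))
        rw [ContinuousLinearMap.coe_coe, sub_sub_cancel] at h
        exact (Submodule.smul_mem_iff _ hc).1 h
  refine .of_dense_generalizedKernel (hd.mono fun x hx => ?_) (hd.mono fun x hx => ?_)
  · obtain ⟨n, hn⟩ := exists_mem_initialSpan hx
    exact ⟨n, pow_apply_eq_zero_of_mem_initialSpan hT hn⟩
  · obtain ⟨n, hn⟩ := exists_mem_initialSpan hx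
    exact hrange n hn

theorem pow_mem_triangularCommutant (k : ℕ) : S ^ (k + 1) ∈ triangularCommutant S e := by
  refine ⟨fun x => ?_, fun n => ?_⟩
  · rw [← mul_apply_eq_comp, ← mul_apply_eq_comp, ← pow_succ, ← pow_succ']
  · obtain h | h := lt_or_ge n (k + 1)
    · rw [hS.pow_apply_of_lt h]; exact zero_mem _
    · obtain ⟨j, rfl⟩ := Nat.exists_eq_add_of_le' h
      rw [hS.pow_apply_add]
      exact mem_initialSpan (by omega)

/-- Evaluating a relation at `e (k + 1)` kills the powers above `k + 1`; the lower coefficients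
vanish by induction. -/
theorem linearIndependent_pow : LinearIndependent 𝕜 fun k : ℕ => S ^ (k + 1) := by
  rw [linearIndependent_iff']
  intro s g hg k
  induction k using Nat.strong_induction_on with
  | _ k ih =>
    intro hk
    have h := congrArg (fun U : X →L[𝕜] X => U (e (k + 1))) hg
    simp only [sum_apply, smul_apply, zero_apply] at h
    rw [Finset.sum_eq_single k ?_ fun h => absurd hk h] at h
    · have he : (S ^ (k + 1)) (e (k + 1)) = e 0 := by simpa using hS.pow_apply_add (k + 1) 0
      rw [he] at h
      exact (smul_eq_zero.1 h).resolve_right hS.ne_zero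
    · intro i hi hik
      obtain h | h := lt_or_gt_of_ne hik
      · rw [ih i h hi, zero_smul]
      · rw [hS.pow_apply_of_lt (Nat.succ_lt_succ h), smul_zero]

theorem spaceable [CompleteSpace X] [TopologicalSpace.SeparableSpace X]
    (hd : Dense (Submodule.span 𝕜 (Set.range e) : Set X)) :
    Spaceable 𝕜 {T : X →L[𝕜] X | IsSupercyclic T} := by
  refine ⟨triangularCommutant S e, fun hfin => ?_, isClosed_triangularCommutant, fun T hT => ?_⟩
  · have hli : LinearIndependent 𝕜 fun k : ℕ =>
        (⟨S ^ (k + 1), hS.pow_mem_triangularCommutant k⟩ : triangularCommutant S e) :=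
      .of_comp (triangularCommutant S e).subtype hS.linearIndependent_pow
    have := hli.finite
    exact not_finite ℕ
  · by_cases h : T = 0
    · exact Or.inr h
    · exact Or.inl (hS.isSupercyclic_of_mem hd hT h)

end ShiftsBackward
end Chain

/-! ### Constructing a shift on a separable Banach space -/

section ExistenceOfShift

variable {𝕜 X : Type*} [RCLike 𝕜] [NormedAddCommGroup X] [NormedSpace 𝕜 X]

theorem exists_linearIndependent_dense_span [TopologicalSpace.SeparableSpace X]
    (hX : ¬ FiniteDimensional 𝕜 X) :
    ∃ y : ℕ → X, LinearIndependent 𝕜 y ∧ Dense (Submodule.span 𝕜 (Set.range y) : Set X) := by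
  obtain ⟨s, hsc, hsd⟩ := TopologicalSpace.exists_countable_dense X
  obtain ⟨b, hbs, hspan, hli⟩ := exists_linearIndependent 𝕜 s
  have hbd : Dense (Submodule.span 𝕜 b : Set X) := by
    rw [hspan]; exact hsd.mono Submodule.subset_span
  have hinf : b.Infinite := by
    intro hfin
    have := FiniteDimensional.span_of_finite 𝕜 hfin
    have htop : Submodule.span 𝕜 b = ⊤ := by
      refine SetLike.coe_injective ?_
      rw [← (Submodule.span 𝕜 b).closed_of_finiteDimensional.closure_eq, hbd.closure_eq]
      rfl
    exact hX (Module.finite_def.2 (htop ▸ Submodule.fg_span hfin))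
  have : Countable b := (hsc.mono hbs).to_subtype
  have : Infinite b := hinf.to_subtype
  obtain ⟨_⟩ := nonempty_denumerable b
  let f : ℕ ≃ b := (Denumerable.eqv b).symm
  refine ⟨fun n => f n, hli.comp f f.injective, ?_⟩
  have : Set.range (fun n => (f n : X)) = b := by
    rw [← Function.comp_def, f.surjective.range_comp, Subtype.range_coe]
  rwa [this]

/-- Hahn–Banach in the quotient `X ⧸ p`. -/
theorem exists_dual_eq_one_of_notMem {p : Submodule 𝕜 X} (hp : IsClosed (p : Set X)) {x : X}
    (hx : x ∉ p) : ∃ f : X →L[𝕜] 𝕜, f x = 1 ∧ ∀ z ∈ p, f z = 0 := by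
  have : IsClosed (p : Set X) := hp
  have hne : p.mkQ x ≠ 0 := by simpa using hx
  obtain ⟨g, hg⟩ := SeparatingDual.exists_eq_one (R := 𝕜) hne
  refine ⟨g.comp p.mkQL, hg, fun z hz => ?_⟩
  have : p.mkQ z = 0 := by simpa using hz
  exact (congrArg g this).trans (map_zero g)

/-- A linearly independent sequence can be made biorthogonal without changing the span of its
initial segments. -/
theorem exists_biorthogonal {y : ℕ → X} (hy : LinearIndependent 𝕜 y) :
    ∃ (x : ℕ → X) (f : ℕ → X →L[𝕜] 𝕜), (∀ i j, f i (x j) = if i = j then 1 else 0) ∧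
      ∀ n, y n ∈ initialSpan 𝕜 x (n + 1) := by
  have hnot : ∀ n, y n ∉ initialSpan 𝕜 y n := fun n =>
    hy.notMem_span_image (lt_irrefl n)
  choose f hf1 hf0 using fun n => exists_dual_eq_one_of_notMem
    (initialSpan 𝕜 y n).closed_of_finiteDimensional (hnot n)
  -- The matrix `f i (y j)` is unitriangular, since `f i` kills `y j` for `j < i`. So only the
  -- vectors need correcting, and the functionals are kept.
  have hsolve : ∀ n v, ∃ z ∈ initialSpan 𝕜 y n, ∀ i < n, f i (v - z) = 0 := by
    intro n
    induction n with
    | zero => exact fun v => ⟨0, zero_mem _, fun i hi => absurd hi (Nat.not_lt_zero i)⟩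
    | succ n ih =>
      intro v
      obtain ⟨z, hz, hfz⟩ := ih v
      obtain ⟨u, hu, hfu⟩ := ih (y n)
      refine ⟨z + f n (v - z) • (y n - u), ?_, fun i hi => ?_⟩
      · exact add_mem (initialSpan_mono n.le_succ hz) (Submodule.smul_mem _ _
          (sub_mem (mem_initialSpan n.lt_succ_self) (initialSpan_mono n.le_succ hu)))
      · rw [← sub_sub, map_sub, map_smul]
        obtain hi | rfl := Nat.lt_succ_iff_lt_or_eq.1 hi
        · rw [hfz i hi, hfu i hi, smul_zero, sub_zero]
        · rw [map_sub _ (y i), hf1, hf0 i u hu, sub_zero, smul_eq_mul, mul_one, sub_self]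
  choose z hz hfz using fun n => hsolve n (y n)
  let x : ℕ → X := fun n => y n - z n
  have hle : ∀ n, initialSpan 𝕜 y n ≤ initialSpan 𝕜 x n := by
    intro n
    induction n with
    | zero => rw [initialSpan_zero]; exact bot_le
    | succ n ih =>
      refine initialSpan_le_iff.2 fun j hj => ?_
      obtain hj | rfl := Nat.lt_succ_iff_lt_or_eq.1 hj
      · exact initialSpan_mono n.le_succ (ih (mem_initialSpan hj))
      · have h := add_mem (mem_initialSpan (𝕜 := 𝕜) (e := x) j.lt_succ_self)
          (initialSpan_mono j.le_succ (ih (hz j)))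
        rwa [sub_add_cancel] at h
  refine ⟨x, f, fun i j => ?_, fun n => hle _ (mem_initialSpan n.lt_succ_self)⟩
  obtain h | rfl | h := lt_trichotomy i j
  · rw [if_neg h.ne]; exact hfz j i h
  · rw [if_pos rfl, map_sub, hf1, hf0 i _ (hz i), sub_zero]
  · rw [if_neg h.ne', map_sub, hf0 i _ (mem_initialSpan h),
      hf0 i _ (initialSpan_mono h.le (hz j)), sub_zero]

/-- A nuclear weighted backward shift along a biorthogonal system. -/
theorem exists_weightedShift [CompleteSpace X] {x : ℕ → X} {f : ℕ → X →L[𝕜] 𝕜}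
    (hxf : ∀ i j, f i (x j) = if i = j then 1 else 0) :
    ∃ (S : X →L[𝕜] X) (w : ℕ → 𝕜), (∀ n, w n ≠ 0) ∧ S (x 0) = 0 ∧
      ∀ n, S (x (n + 1)) = w n • x n := by
  let u : ℕ → X →L[𝕜] X := fun n => (f (n + 1)).smulRight (x n)
  -- Dividing by `1 + ‖u n‖` makes the series of rank-one operators converge in norm.
  let w : ℕ → ℝ := fun n => (1 / 2) ^ n / (1 + ‖u n‖)
  have hw : ∀ n, 0 < w n := fun n => by positivity
  have hsum : Summable fun n => (w n : 𝕜) • u n := by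
    refine Summable.of_norm_bounded summable_geometric_two fun n => ?_
    rw [norm_smul, RCLike.norm_ofReal, abs_of_pos (hw n), div_mul_eq_mul_div,
      div_le_iff₀ (by positivity)]
    gcongr
    linarith
  have hS : ∀ v, HasSum (fun n => ((w n : 𝕜) • u n) v) ((∑' n, (w n : 𝕜) • u n) v) := fun v =>
    hsum.hasSum.mapL (ContinuousLinearMap.apply 𝕜 X v)
  refine ⟨∑' n, (w n : 𝕜) • u n, fun n => (w n : 𝕜), fun n => ?_, ?_, fun n => ?_⟩
  · exact RCLike.ofReal_ne_zero.2 (hw n).ne'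
  · refine (hS (x 0)).unique ?_
    simp [u, hxf]
  · refine (hS (x (n + 1))).unique ?_
    convert hasSum_ite_eq n ((w n : 𝕜) • x n) using 2 with i
    by_cases h : i = n
    · subst h; simp [u, hxf]
    · simp [u, hxf, h]

theorem exists_shiftsBackward [CompleteSpace X] [TopologicalSpace.SeparableSpace X]
    (hX : ¬ FiniteDimensional 𝕜 X) :
    ∃ (S : X →L[𝕜] X) (e : ℕ → X), ShiftsBackward S e ∧
      Dense (Submodule.span 𝕜 (Set.range e) : Set X) := by
  obtain ⟨y, hy, hyd⟩ := exists_linearIndependent_dense_span (𝕜 := 𝕜) hX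
  obtain ⟨x, f, hxf, hyx⟩ := exists_biorthogonal hy
  obtain ⟨S, w, hw, hS0, hS⟩ := exists_weightedShift hxf
  -- Rescaling `x n` by `c n` absorbs the weights: `c (n + 1) * w n = c n`.
  let c : ℕ → 𝕜 := fun n => ∏ i ∈ Finset.range n, (w i)⁻¹
  have hc : ∀ n, c n ≠ 0 := fun n => Finset.prod_ne_zero_iff.2 fun i _ => inv_ne_zero (hw i)
  refine ⟨S, fun n => c n • x n, ⟨?_, fun n => ?_, ?_⟩, hyd.mono ?_⟩
  · simp [hS0]
  · have hsucc : c (n + 1) = c n * (w n)⁻¹ := Finset.prod_range_succ _ n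
    rw [map_smul, hS, smul_smul, hsucc, inv_mul_cancel_right₀ (hw n)]
  · refine smul_ne_zero (hc 0) fun h => ?_
    have h0 := hxf 0 0
    simp [h] at h0
  · refine Submodule.span_le.2 ?_
    rintro _ ⟨n, rfl⟩
    refine initialSpan_le_iff.2 (fun j _ => ?_) (hyx n)
    exact (Submodule.smul_mem_iff _ (hc j)).1 (Submodule.subset_span ⟨j, rfl⟩)

end ExistenceOfShift

/-! ### Density of the unit vectors and separability of `ℓ₁` -/

namespace EllOne

variable {𝕜 : Type*} [RCLike 𝕜]

theorem dense_span_single :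
    Dense (Submodule.span 𝕜 (Set.range fun n : ℕ => (lp.single 1 n (1 : 𝕜) : EllOne 𝕜)) :
      Set (EllOne 𝕜)) := by
  intro x
  refine mem_closure_of_tendsto (lp.hasSum_single ENNReal.one_ne_top x)
    (Filter.Eventually.of_forall fun s => sum_mem fun n _ => ?_)
  have : (lp.single 1 n (x n) : EllOne 𝕜) = x n • lp.single 1 n (1 : 𝕜) := by
    rw [← lp.single_smul, smul_eq_mul, mul_one]
  rw [this]
  exact Submodule.smul_mem _ _ (Submodule.subset_span ⟨n, rfl⟩)

instance : TopologicalSpace.SeparableSpace (EllOne 𝕜) := by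
  have h := (Set.countable_range fun n : ℕ => (lp.single 1 n (1 : 𝕜) : EllOne 𝕜)).isSeparable
  have := (h.span (R := 𝕜)).closure
  rw [dense_span_single.closure_eq] at this
  exact TopologicalSpace.isSeparable_univ_iff.1 this

end EllOne

/-! ### Series in powers of the backward shift -/

section BackwardShift

variable {𝕜 : Type*} [RCLike 𝕜]

theorem shiftsBackward_backwardShift :
    ShiftsBackward (backwardShift 𝕜) fun n : ℕ => (lp.single 1 n (1 : 𝕜) : EllOne 𝕜) := by
  refine ⟨?_, fun n => ?_, fun h => ?_⟩
  · ext i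
    simp [backwardShift_apply]
  · ext i
    simp [backwardShift_apply, Pi.single_apply]
  · have := congrArg (fun x : EllOne 𝕜 => x 0) h
    simp at this

theorem norm_backwardShift_le : ‖backwardShift 𝕜‖ ≤ 1 :=
  LinearMap.mkContinuous_norm_le _ zero_le_one _

theorem norm_smul_backwardShift_pow_le (c : 𝕜) (k : ℕ) :
    ‖c • backwardShift 𝕜 ^ (k + 1)‖ ≤ ‖c‖ := by
  rw [norm_smul]
  refine mul_le_of_le_one_right (norm_nonneg c) ((norm_pow_le' _ k.succ_pos).trans ?_)
  exact pow_le_one₀ (norm_nonneg _) norm_backwardShift_le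

theorem summable_smul_backwardShift_pow (a : EllOne 𝕜) :
    Summable fun k : ℕ => a k • backwardShift 𝕜 ^ (k + 1) :=
  .of_norm_bounded a.summable_norm fun k => norm_smul_backwardShift_pow_le (a k) k

theorem backwardShift_pow_apply (k : ℕ) (x : EllOne 𝕜) (n : ℕ) :
    (backwardShift 𝕜 ^ k) x n = x (n + k) := by
  induction k generalizing n with
  | zero => rfl
  | succ k ih =>
    rw [pow_succ', mul_apply_eq_comp, backwardShift_apply, ih, add_right_comm, add_assoc]

/-- Only the power `k + 1 = n - i` moves the unit vector at `n` to position `i`. -/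
theorem tsum_smul_backwardShift_pow_apply (a : EllOne 𝕜) {i n : ℕ} (h : i < n) :
    (∑' k : ℕ, a k • backwardShift 𝕜 ^ (k + 1)) (lp.single 1 n (1 : 𝕜) : EllOne 𝕜) i =
      a (n - 1 - i) := by
  have h1 := (summable_smul_backwardShift_pow a).hasSum.mapL
    (ContinuousLinearMap.apply 𝕜 (EllOne 𝕜) (lp.single 1 n (1 : 𝕜) : EllOne 𝕜))
  have h2 := h1.mapL (lp.evalCLM 𝕜 (fun _ : ℕ => 𝕜) 1 i)
  have hcoeff : ∀ k, (a k • backwardShift 𝕜 ^ (k + 1)) (lp.single 1 n (1 : 𝕜) : EllOne 𝕜) i =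
      if k = n - 1 - i then a (n - 1 - i) else 0 := by
    intro k
    change a k • (backwardShift 𝕜 ^ (k + 1)) (lp.single 1 n (1 : 𝕜) : EllOne 𝕜) i = _
    rw [backwardShift_pow_apply, lp.single_apply, Pi.single_apply]
    by_cases hk : k = n - 1 - i
    · subst hk
      rw [if_pos (by omega), if_pos rfl, smul_eq_mul, mul_one]
    · rw [if_neg (by omega), if_neg hk, smul_zero]
  have h3 := hasSum_ite_eq (n - 1 - i) (a (n - 1 - i))
  rw [← funext hcoeff] at h3
  exact h2.unique h3

theorem norm_tsum_smul_backwardShift_pow (a : EllOne 𝕜) :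
    ‖∑' k : ℕ, a k • backwardShift 𝕜 ^ (k + 1)‖ = ‖a‖ := by
  refine le_antisymm ?_ ?_
  · rw [EllOne.norm_eq]
    exact tsum_of_norm_bounded a.summable_norm.hasSum fun k =>
      norm_smul_backwardShift_pow_le (a k) k
  · set T := ∑' k : ℕ, a k • backwardShift 𝕜 ^ (k + 1) with hT
    rw [EllOne.norm_eq]
    refine Real.tsum_le_of_sum_range_le (fun _ => norm_nonneg _) fun n => ?_
    let e : EllOne 𝕜 := lp.single 1 n (1 : 𝕜)
    have he : ‖e‖ = 1 := (lp.norm_single (E := fun _ : ℕ => 𝕜) one_pos n (1 : 𝕜)).trans norm_one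
    -- The first `n` coordinates of `T e` are `a 0, …, a (n - 1)` in reverse order, so a unit vector
    -- already sees the partial sum.
    calc ∑ k ∈ Finset.range n, ‖a k‖ = ∑ i ∈ Finset.range n, ‖T e i‖ := by
          rw [← Finset.sum_range_reflect]
          refine Finset.sum_congr rfl fun i hi => ?_
          rw [hT, tsum_smul_backwardShift_pow_apply a (Finset.mem_range.1 hi)]
      _ ≤ ‖T e‖ := by
          rw [EllOne.norm_eq (T e)]
          exact (T e).summable_norm.sum_le_tsum _ fun _ _ => norm_nonneg _
      _ ≤ ‖T‖ := T.le_of_opNorm_le_of_le le_rfl he.le |>.trans_eq (mul_one _)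

variable (𝕜) in
/-- The isometry `a ↦ ∑ a k • B ^ (k + 1)` of `ℓ₁` into the operators on `ℓ₁`. -/
noncomputable def shiftSeries : EllOne 𝕜 →ₗᵢ[𝕜] (EllOne 𝕜 →L[𝕜] EllOne 𝕜) where
  toFun a := ∑' k : ℕ, a k • backwardShift 𝕜 ^ (k + 1)
  map_add' a b := by
    rw [← (summable_smul_backwardShift_pow a).tsum_add (summable_smul_backwardShift_pow b)]
    exact tsum_congr fun k => add_smul _ _ _
  map_smul' c a := by
    rw [RingHom.id_apply, ← (summable_smul_backwardShift_pow a).tsum_const_smul c]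
    exact tsum_congr fun k => mul_smul _ _ _
  norm_map' := norm_tsum_smul_backwardShift_pow

theorem hasSum_shiftSeries (a : EllOne 𝕜) :
    HasSum (fun k : ℕ => a k • backwardShift 𝕜 ^ (k + 1)) (shiftSeries 𝕜 a) :=
  (summable_smul_backwardShift_pow a).hasSum

theorem shiftSeries_mem_triangularCommutant (a : EllOne 𝕜) :
    shiftSeries 𝕜 a ∈ triangularCommutant (backwardShift 𝕜)
      fun n : ℕ => (lp.single 1 n (1 : 𝕜) : EllOne 𝕜) :=
  isClosed_triangularCommutant.mem_of_tendsto (hasSum_shiftSeries a)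
    (Filter.Eventually.of_forall fun _ => sum_mem fun k _ => Submodule.smul_mem _ _
      (shiftsBackward_backwardShift.pow_mem_triangularCommutant k))

end BackwardShift

theorem theorem1 {𝕜 : Type*} [RCLike 𝕜] :
    (∀ (X : Type*) [NormedAddCommGroup X] [NormedSpace 𝕜 X] [CompleteSpace X]
        [TopologicalSpace.SeparableSpace X], ¬ FiniteDimensional 𝕜 X →
        Spaceable 𝕜 {T : X →L[𝕜] X | IsSupercyclic T}) ∧
      ∃ Φ : EllOne 𝕜 →ₗᵢ[𝕜] (EllOne 𝕜 →L[𝕜] EllOne 𝕜),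
        (∀ a : EllOne 𝕜, HasSum (fun k : ℕ => a k • backwardShift 𝕜 ^ (k + 1)) (Φ a)) ∧
        IsClosed (Set.range Φ) ∧
        Set.range Φ ⊆ {T : EllOne 𝕜 →L[𝕜] EllOne 𝕜 | IsSupercyclic T} ∪ {0} := by
  refine ⟨fun X _ _ _ _ hX => ?_, shiftSeries 𝕜, hasSum_shiftSeries,
    (shiftSeries 𝕜).isometry.isClosedEmbedding.isClosed_range, ?_⟩
  · obtain ⟨S, e, hS, hd⟩ := exists_shiftsBackward hX
    exact hS.spaceable hd
  · rintro _ ⟨a, rfl⟩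
    by_cases h : shiftSeries 𝕜 a = 0
    · exact Or.inr h
    · exact Or.inl (shiftsBackward_backwardShift.isSupercyclic_of_mem EllOne.dense_span_single
        (shiftSeries_mem_triangularCommutant a) h)
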